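/- There exist absolute constants $\alpha_0>0$ and $c>0$ such that the following holds for all $\alpha\in(0,\alpha_0]$, all $d,n\in\mathbb N$, all $\varepsilon\in(0,1]$ and all $\delta\in[0,\frac{1}{100n}]$. For a probability distribution $P$ on $\{0,1\}^d$ and a randomized algorithm $\mathcal A:(\{0,1\}^d)^n\to\{0,1\}^d$ (a *sampler*), let $Q_{\mathcal A,P}$ be the distribution of $\mathcal A(X_1,\dots,X_n)$, where $X_1,\dots,X_n$ are drawn i.i.d. from $P$, independently of the coins of $\mathcal A$. Suppose that there is a sampler $\mathcal A$ such that 1. $\mathcal A$ is $(\varepsilon,\delta)$-differentially private: for all datasets $x,x'\in(\{0,1\}^d)^n$ that differ in at most one record and all $Y\subseteq\{0,1\}^d$, $\Pr[\mathcal A(x)\in Y]\le e^{\varepsilon}\Pr[\mathcal A(x')\in Y]+\delta$; 2. $\mathcal A$ is $\alpha$-accurate on the class of products of $d$ Bernoulli distributions with biases in $[\frac13,\frac23]$: for all $p_1,\dots,p_d\in[\frac13,\frac23]$ and $P=\mathrm{Ber}(p_1)\otimes\dots\otimes\mathrm{Ber}(p_d)$, $\sup_{E\subseteq\{0,1\}^d}|Q_{\mathcal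 A,P}(E)-P(E)|\le\alpha$. Then $n\ge c\,\sqrt d/\varepsilon$. -/

import Mathlib

namespace PrivateSampling

open MeasureTheory ProbabilityTheory

/-- A randomized algorithm on datasets of `n` records from the universe `U`: for every dataset `x`,
the probability distribution `A x` of the output (over the coins of the algorithm). Used together
with `IsMarkovKernel A`, which says that each `A x` is a probability distribution. -/
abbrev Algorithm (n : ℕ) (U Y : Type*) [MeasurableSpace U] [MeasurableSpace Y] :=
  Kernel (Fin n → U) Y

/-- Neighbouring datasets: they differ in at most one record. -/
def Neighbors {n : ℕ} {U : Type*} (x x' : Fin n → U) : Prop :=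
  {i : Fin n | x i ≠ x' i}.Subsingleton

/-- `(ε, δ)`-differential privacy: `Pr[A(x) ∈ Y] ≤ e^ε Pr[A(x') ∈ Y] + δ` for all neighbouring
datasets `x, x'` and all events `Y` (every set of outputs is an event in a finite discrete
space). -/
def IsDP {n : ℕ} {U V : Type*} [MeasurableSpace U] [MeasurableSpace V]
    (A : Algorithm n U V) (ε δ : ℝ) : Prop :=
  ∀ x x' : Fin n → U, Neighbors x x' → ∀ Y : Set V, MeasurableSet Y →
    (A x).real Y ≤ Real.exp ε * (A x').real Y + δ

/-- Total variation distance of two probability measures: the supremum over all events `E` of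
`|P(E) - Q(E)|`. -/
noncomputable def tvDist {U : Type*} [MeasurableSpace U] (P Q : Measure U) : ℝ :=
  ⨆ E : {E : Set U // MeasurableSet E}, |P.real E.1 - Q.real E.1|

/-- The distribution of `A(X)` where the dataset `X` consists of `n` i.i.d. draws from `P`
(the randomness is that of `X` and of the coins of `A`). -/
noncomputable def outputDist {n : ℕ} {U : Type*} [MeasurableSpace U]
    (A : Algorithm n U U) (P : Measure U) : Measure U :=
  (Measure.pi (fun _ : Fin n => P)).bind A

/-- The sampler `A` is `α`-accurate on the class `C` of distributions. -/
def IsAccurateOn {n : ℕ} {U : Type*} [MeasurableSpace U]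
    (A : Algorithm n U U) (α : ℝ) (C : Set (Measure U)) : Prop :=
  ∀ P ∈ C, tvDist (outputDist A P) P ≤ α

/-- The product on `{0,1}^d` of the Bernoulli distributions with biases `p 0, …, p (d - 1)`. -/
noncomputable def productBernoulli {d : ℕ} (p : Fin d → unitInterval) : Measure (Fin d → Bool) :=
  Measure.pi (fun j : Fin d => bernoulliMeasure true false (p j))

/-- The class of products of `d` Bernoulli distributions with all biases in `[1/3, 2/3]`. -/
def boundedBiasProducts (d : ℕ) : Set (Measure (Fin d → Bool)) :=
  {P | ∃ p : Fin d → unitInterval,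
    (∀ j, (1 / 3 : ℝ) ≤ (p j : ℝ) ∧ (p j : ℝ) ≤ 2 / 3) ∧ P = productBernoulli p}

end PrivateSampling

namespace PrivateSampling

open MeasureTheory ProbabilityTheory

/-! This is a fingerprinting argument, with the divergence theorem in place of a random choice of
biases. Let `G j p` be the mean of the `j`-th output bit minus 1/2 when the records have biases `p`.
Accuracy is used only on one-bit events: it makes `G` uniformly `α`-close to `p - 1/2`, so the flux
of `G` out of the cube `[1/3, 2/3]^d` forces its average divergence to be at least `d (1 - 6α)`
(`le_of_divergence_le`).

Differentiating the dataset mass produces scores, so the divergence at `p` is the sum over records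
`i` of the expected `scoreCorrelation` between record `i` and the output. Privacy makes each term
small: if the algorithm is run with record `i` overwritten, output and record are independent, the
correlation has mean zero and typical size `√d`, and undoing the change costs `O(ε √d + δ d)`
(`sum_datasetMass_mul_scoreCorrelation_le`). Hence `d ≲ n (ε √d + δ d)`, and `δ ≤ 1/(100 n)` lets
the last term be absorbed on the left. -/

/-- The mass that the Bernoulli distribution of bias `p` gives to a bit. -/
noncomputable def bitMass (p : ℝ) (b : Bool) : ℝ := if b then p else 1 - p

/-- The score (logarithmic derivative in `p`) of the Bernoulli distribution. -/
noncomputable def bitScore (p : ℝ) (b : Bool) : ℝ := if b then 1 / p else -(1 / (1 - p))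

/-- A bit, centred to take the values `1/2` and `-1/2`. -/
noncomputable def centeredBit (b : Bool) : ℝ := if b then 1 / 2 else -(1 / 2)

/-- The mass that the product of Bernoulli distributions gives to a record. -/
noncomputable def recordMass {d : ℕ} (p : Fin d → ℝ) (r : Fin d → Bool) : ℝ :=
  ∏ j, bitMass (p j) (r j)

/-- The mass that the law of `n` i.i.d. records gives to a dataset. -/
noncomputable def datasetMass {d n : ℕ} (p : Fin d → ℝ) (x : Fin n → Fin d → Bool) : ℝ :=
  ∏ i, recordMass p (x i)

/-- The fingerprinting statistic: the correlation of an output with the score of a record. -/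
noncomputable def scoreCorrelation {d : ℕ} (p : Fin d → ℝ) (r y : Fin d → Bool) : ℝ :=
  ∑ j, centeredBit (y j) * bitScore (p j) (r j)

/-! ### Finite product laws: resampling a coordinate, means and variances -/

section Resampling

variable {ι U : Type*} [Fintype ι] [DecidableEq ι]

lemma prod_update_mul_swap (v : ι → U → ℝ) (i : ι) (x : ι → U) (r : U) :
    (∏ k, v k (Function.update x i r k)) * v i (x i) = (∏ k, v k (x k)) * v i r := by
  rw [← Finset.mul_prod_erase Finset.univ _ (Finset.mem_univ i),
    ← Finset.mul_prod_erase Finset.univ (fun k => v k (x k)) (Finset.mem_univ i)]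
  have h : ∏ k ∈ Finset.univ.erase i, v k (Function.update x i r k)
      = ∏ k ∈ Finset.univ.erase i, v k (x k) :=
    Finset.prod_congr rfl fun k hk => by
      rw [Function.update_of_ne (Finset.ne_of_mem_erase hk)]
  rw [h, Function.update_self]
  ring

variable [Fintype U]

/-- Under a product law, one coordinate may be replaced by a fresh copy. -/
lemma sum_prod_mul_eq_sum_resample (v : ι → U → ℝ) (i : ι) (hv : ∑ r, v i r = 1)
    (F : (ι → U) → ℝ) :
    ∑ x, (∏ k, v k (x k)) * F x
      = ∑ x, (∏ k, v k (x k)) * ∑ r, v i r * F (Function.update x i r) := by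
  have h1 : ∑ x, (∏ k, v k (x k)) * F x
      = ∑ z : (ι → U) × U, (∏ k, v k (z.1 k)) * v i z.2 * F z.1 := by
    rw [Fintype.sum_prod_type]
    refine Finset.sum_congr rfl fun x _ => ?_
    simp only
    rw [← Finset.sum_mul, ← Finset.mul_sum, hv, mul_one]
  have h2 : ∑ x, (∏ k, v k (x k)) * ∑ r, v i r * F (Function.update x i r)
      = ∑ z : (ι → U) × U, (∏ k, v k (z.1 k)) * v i z.2 * F (Function.update z.1 i z.2) := by
    rw [Fintype.sum_prod_type]
    refine Finset.sum_congr rfl fun x _ => ?_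
    rw [Finset.mul_sum]
    exact Finset.sum_congr rfl fun r _ => by ring
  rw [h1, h2]
  -- Swapping `x i` with the fresh copy is an involution that preserves the joint mass.
  let e : (ι → U) × U → (ι → U) × U := fun z => (Function.update z.1 i z.2, z.1 i)
  have he : Function.Involutive e := fun z => by simp [e]
  rw [← Equiv.sum_comp he.toPerm]
  refine Finset.sum_congr rfl fun z _ => ?_
  simp only [Function.Involutive.coe_toPerm, e]
  rw [prod_update_mul_swap]

lemma sum_prod_eq_one (v : ι → U → ℝ) (hv : ∀ i, ∑ r, v i r = 1) :
    ∑ x : ι → U, ∏ k, v k (x k) = 1 := by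
  rw [← Fintype.piFinset_univ, ← Finset.prod_univ_sum]
  simp [hv]

lemma sum_prod_mul_coord (v : ι → U → ℝ) (hv : ∀ i, ∑ r, v i r = 1) (i : ι) (h : U → ℝ) :
    ∑ x : ι → U, (∏ k, v k (x k)) * h (x i) = ∑ r, v i r * h r := by
  rw [sum_prod_mul_eq_sum_resample v i (hv i)]
  simp only [Function.update_self]
  rw [← Finset.sum_mul, sum_prod_eq_one v hv, one_mul]

lemma sum_prod_mul_sum_eq_zero (v : ι → U → ℝ) (hv : ∀ i, ∑ r, v i r = 1) (h : ι → U → ℝ)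
    (hh : ∀ i, ∑ r, v i r * h i r = 0) :
    ∑ x : ι → U, (∏ k, v k (x k)) * ∑ i, h i (x i) = 0 := by
  simp only [Finset.mul_sum]
  rw [Finset.sum_comm]
  exact Finset.sum_eq_zero fun i _ => (sum_prod_mul_coord v hv i (h i)).trans (hh i)

/-- The variance of a sum of independent centred variables is the sum of the variances. -/
lemma sum_prod_mul_sum_sq (v : ι → U → ℝ) (hv : ∀ i, ∑ r, v i r = 1) (h : ι → U → ℝ)
    (hh : ∀ i, ∑ r, v i r * h i r = 0) :
    ∑ x : ι → U, (∏ k, v k (x k)) * (∑ i, h i (x i)) ^ 2 = ∑ i, ∑ r, v i r * h i r ^ 2 := by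
  have hcross : ∀ i j, i ≠ j →
      ∑ x : ι → U, (∏ k, v k (x k)) * (h i (x i) * h j (x j)) = 0 := by
    intro i j hij
    rw [sum_prod_mul_eq_sum_resample v i (hv i)]
    refine Finset.sum_eq_zero fun x _ => ?_
    simp only [Function.update_self, Function.update_of_ne hij.symm]
    simp only [← mul_assoc]
    rw [← Finset.sum_mul, hh, zero_mul, mul_zero]
  have hsq : ∀ x : ι → U, (∑ i, h i (x i)) ^ 2 = ∑ i, ∑ j, h i (x i) * h j (x j) := fun x => by
    rw [sq, Finset.sum_mul_sum]
  simp only [hsq, Finset.mul_sum]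
  rw [Finset.sum_comm]
  refine Finset.sum_congr rfl fun i _ => ?_
  rw [Finset.sum_comm, Finset.sum_eq_single i (fun j _ hj => hcross i j hj.symm) (by simp)]
  simp only [sq]
  exact sum_prod_mul_coord v hv i fun r => h i r * h i r

end Resampling

/-! ### Moments of the score correlation against a fixed output -/

section RecordMoments

lemma sum_bitMass (p : ℝ) : ∑ b, bitMass p b = 1 := by simp [bitMass]

lemma bitMass_nonneg {p : ℝ} (h0 : 0 ≤ p) (h1 : p ≤ 1) (b : Bool) : 0 ≤ bitMass p b := by
  cases b <;> simp [bitMass] <;> linarith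

lemma abs_centeredBit (b : Bool) : |centeredBit b| = 1 / 2 := by
  cases b <;> norm_num [centeredBit, abs_of_pos, abs_of_neg]

lemma abs_bitScore_le {p : ℝ} (h0 : 1 / 3 ≤ p) (h1 : p ≤ 2 / 3) (b : Bool) :
    |bitScore p b| ≤ 3 := by
  cases b
  · simp only [bitScore, Bool.false_eq_true, if_false, abs_neg]
    rw [abs_of_nonneg (by apply one_div_nonneg.2; linarith), div_le_iff₀ (by linarith)]
    linarith
  · simp only [bitScore, if_true]
    rw [abs_of_nonneg (by apply one_div_nonneg.2; linarith), div_le_iff₀ (by linarith)]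
    linarith

lemma sum_bitMass_mul_bitScore {p : ℝ} (h0 : 1 / 3 ≤ p) (h1 : p ≤ 2 / 3) :
    ∑ b, bitMass p b * bitScore p b = 0 := by
  have hp : p ≠ 0 := by linarith
  have hp' : 1 - p ≠ 0 := by linarith
  simp [bitMass, bitScore, hp, hp']

lemma sum_bitMass_mul_bitScore_sq {p : ℝ} (h0 : 1 / 3 ≤ p) (h1 : p ≤ 2 / 3) :
    ∑ b, bitMass p b * bitScore p b ^ 2 ≤ 9 / 2 := by
  have hp : 0 < p := by linarith
  have hp' : 0 < 1 - p := by linarith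
  have : ∑ b, bitMass p b * bitScore p b ^ 2 = 1 / (p * (1 - p)) := by
    simp only [bitMass, bitScore, Fintype.sum_bool, if_true, Bool.false_eq_true, if_false]
    field_simp
    ring
  -- On `[1/3, 2/3]` the product `p (1 - p)` is smallest at the endpoints, where it is 2/9.
  rw [this, div_le_iff₀ (by positivity)]
  nlinarith

variable {d : ℕ} {p : Fin d → ℝ}

lemma sum_recordMass (p : Fin d → ℝ) : ∑ r, recordMass p r = 1 :=
  sum_prod_eq_one (fun j => bitMass (p j)) fun j => sum_bitMass (p j)

lemma recordMass_nonneg (hp : ∀ j, 1 / 3 ≤ p j ∧ p j ≤ 2 / 3) (r : Fin d → Bool) :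
    0 ≤ recordMass p r :=
  Finset.prod_nonneg fun j _ =>
    bitMass_nonneg (by linarith [(hp j).1]) (by linarith [(hp j).2]) _

lemma sum_datasetMass (n : ℕ) (p : Fin d → ℝ) :
    ∑ x : Fin n → Fin d → Bool, datasetMass p x = 1 :=
  sum_prod_eq_one (fun _ => recordMass p) fun _ => sum_recordMass p

lemma datasetMass_nonneg {n : ℕ} (hp : ∀ j, 1 / 3 ≤ p j ∧ p j ≤ 2 / 3)
    (x : Fin n → Fin d → Bool) : 0 ≤ datasetMass p x :=
  Finset.prod_nonneg fun _ _ => recordMass_nonneg hp _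

lemma abs_scoreCorrelation_le (hp : ∀ j, 1 / 3 ≤ p j ∧ p j ≤ 2 / 3) (r y : Fin d → Bool) :
    |scoreCorrelation p r y| ≤ 3 / 2 * d := by
  calc |scoreCorrelation p r y| ≤ ∑ j, |centeredBit (y j) * bitScore (p j) (r j)| :=
        Finset.abs_sum_le_sum_abs _ _
    _ ≤ ∑ _j : Fin d, (3 / 2 : ℝ) := by
        refine Finset.sum_le_sum fun j _ => ?_
        rw [abs_mul, abs_centeredBit]
        linarith [abs_bitScore_le (hp j).1 (hp j).2 (r j)]
    _ = 3 / 2 * d := by simp [mul_comm]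

lemma sum_bitMass_mul_centered (hp : ∀ j, 1 / 3 ≤ p j ∧ p j ≤ 2 / 3) (y : Fin d → Bool)
    (j : Fin d) : ∑ b, bitMass (p j) b * (centeredBit (y j) * bitScore (p j) b) = 0 := by
  have h := sum_bitMass_mul_bitScore (hp j).1 (hp j).2
  calc _ = centeredBit (y j) * ∑ b, bitMass (p j) b * bitScore (p j) b := by
        rw [Finset.mul_sum]; exact Finset.sum_congr rfl fun _ _ => by ring
    _ = 0 := by rw [h, mul_zero]

lemma sum_recordMass_mul_scoreCorrelation (hp : ∀ j, 1 / 3 ≤ p j ∧ p j ≤ 2 / 3)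
    (y : Fin d → Bool) : ∑ r, recordMass p r * scoreCorrelation p r y = 0 :=
  sum_prod_mul_sum_eq_zero (fun j => bitMass (p j)) (fun j => sum_bitMass (p j))
    (fun j b => centeredBit (y j) * bitScore (p j) b) (sum_bitMass_mul_centered hp y)

lemma sum_recordMass_mul_scoreCorrelation_sq (hp : ∀ j, 1 / 3 ≤ p j ∧ p j ≤ 2 / 3)
    (y : Fin d → Bool) : ∑ r, recordMass p r * scoreCorrelation p r y ^ 2 ≤ 9 / 8 * d := by
  have h := sum_prod_mul_sum_sq (fun j => bitMass (p j)) (fun j => sum_bitMass (p j))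
    (fun j b => centeredBit (y j) * bitScore (p j) b) (sum_bitMass_mul_centered hp y)
  refine h.le.trans ?_
  calc _ ≤ ∑ _j : Fin d, (9 / 8 : ℝ) := by
        refine Finset.sum_le_sum fun j _ => ?_
        have hc : centeredBit (y j) ^ 2 = 1 / 4 := by
          rw [← sq_abs, abs_centeredBit]; norm_num
        simp only [mul_pow, hc]
        have := sum_bitMass_mul_bitScore_sq (hp j).1 (hp j).2
        calc _ = 1 / 4 * ∑ b, bitMass (p j) b * bitScore (p j) b ^ 2 := by
              rw [Finset.mul_sum]; exact Finset.sum_congr rfl fun _ _ => by ring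
          _ ≤ 9 / 8 := by linarith
    _ = 9 / 8 * d := by simp [mul_comm]

/-- AM-GM, `2 √d |Z| ≤ Z² + d`, combined with the second moment `9/8 d`, gives `17/8 d / (2 √d)`. -/
lemma sum_recordMass_mul_abs_scoreCorrelation (hp : ∀ j, 1 / 3 ≤ p j ∧ p j ≤ 2 / 3)
    (y : Fin d → Bool) :
    ∑ r, recordMass p r * |scoreCorrelation p r y| ≤ 17 / 16 * Real.sqrt d := by
  rcases Nat.eq_zero_or_pos d with rfl | hd
  · simp [scoreCorrelation]
  have hs : 0 < Real.sqrt d := Real.sqrt_pos.2 (by exact_mod_cast hd)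
  have hss : Real.sqrt d * Real.sqrt d = d := Real.mul_self_sqrt (Nat.cast_nonneg d)
  have h2 : (2 * Real.sqrt d) * ∑ r, recordMass p r * |scoreCorrelation p r y|
      ≤ ∑ r, recordMass p r * scoreCorrelation p r y ^ 2 + d * ∑ r, recordMass p r := by
    rw [Finset.mul_sum, Finset.mul_sum, ← Finset.sum_add_distrib]
    refine Finset.sum_le_sum fun r _ => ?_
    have h0 := recordMass_nonneg hp r
    have : 2 * Real.sqrt d * |scoreCorrelation p r y| ≤ scoreCorrelation p r y ^ 2 + d := by
      rw [← sq_abs (scoreCorrelation p r y)]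
      nlinarith [sq_nonneg (|scoreCorrelation p r y| - Real.sqrt d)]
    nlinarith
  rw [sum_recordMass] at h2
  have h3 := sum_recordMass_mul_scoreCorrelation_sq hp y
  refine le_of_mul_le_mul_left ?_ (by positivity : 0 < 2 * Real.sqrt d)
  nlinarith

end RecordMoments

/-! ### Privacy bounds the correlation of the output with each record -/

section Privacy

variable {Y : Type*} [Fintype Y]

/-- Approximate indistinguishability on events extends to bounded nonnegative functions. -/
lemma sum_mul_le_of_events {f g : Y → ℝ} {E δ M : ℝ}
    (h : ∀ S : Finset Y, ∑ y ∈ S, f y ≤ E * ∑ y ∈ S, g y + δ)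
    {z : Y → ℝ} (hz0 : ∀ y, 0 ≤ z y) (hzM : ∀ y, z y ≤ M) (hM : 0 ≤ M) :
    ∑ y, f y * z y ≤ E * ∑ y, g y * z y + δ * M := by
  classical
  -- The worst event: the outputs where `f` exceeds `E * g`.
  let S : Finset Y := Finset.univ.filter fun y => E * g y < f y
  have hS : ∑ y ∈ S, (f y - E * g y) ≤ δ := by
    rw [Finset.sum_sub_distrib, ← Finset.mul_sum]
    linarith [h S]
  have h1 : ∑ y, (f y - E * g y) * z y ≤ (∑ y ∈ S, (f y - E * g y)) * M := by
    rw [Finset.sum_mul, Finset.sum_filter]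
    refine Finset.sum_le_sum fun y _ => ?_
    split_ifs with hy
    · exact mul_le_mul_of_nonneg_left (hzM y) (by linarith)
    · exact mul_nonpos_of_nonpos_of_nonneg (by linarith) (hz0 y)
  have h2 : ∑ y, (f y - E * g y) * z y = ∑ y, f y * z y - E * ∑ y, g y * z y := by
    rw [Finset.mul_sum, ← Finset.sum_sub_distrib]
    exact Finset.sum_congr rfl fun y _ => by ring
  nlinarith [mul_le_mul_of_nonneg_right hS hM]

/-- Expectations of a bounded function under two indistinguishable distributions. -/
lemma sum_mul_le_of_indistinguishable {f g : Y → ℝ} {ε δ M : ℝ} (hε0 : 0 ≤ ε) (hε1 : ε ≤ 1)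
    (hδ : 0 ≤ δ) (hg : ∀ y, 0 ≤ g y)
    (hfg : ∀ S : Finset Y, ∑ y ∈ S, f y ≤ Real.exp ε * ∑ y ∈ S, g y + δ)
    (hgf : ∀ S : Finset Y, ∑ y ∈ S, g y ≤ Real.exp ε * ∑ y ∈ S, f y + δ)
    {z : Y → ℝ} (hz : ∀ y, |z y| ≤ M) (hM : 0 ≤ M) :
    ∑ y, f y * z y ≤ ∑ y, g y * z y + 2 * ε * ∑ y, g y * |z y| + 2 * (δ * M) := by
  have hpos := sum_mul_le_of_events hfg (z := fun y => (z y)⁺) (fun y => posPart_nonneg _)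
    (fun y => sup_le ((le_abs_self _).trans (hz y)) hM) hM
  -- The negative part enters with a minus sign, so it needs the reverse comparison.
  have hneg := sum_mul_le_of_events hgf (z := fun y => (z y)⁻) (fun y => negPart_nonneg _)
    (fun y => sup_le ((neg_le_abs _).trans (hz y)) hM) hM
  have split : ∀ k : Y → ℝ, ∑ y, k y * z y = ∑ y, k y * (z y)⁺ - ∑ y, k y * (z y)⁻ := by
    intro k
    rw [← Finset.sum_sub_distrib]
    refine Finset.sum_congr rfl fun y _ => ?_
    rw [← mul_sub, posPart_sub_negPart]
  have habs : ∑ y, g y * |z y| = ∑ y, g y * (z y)⁺ + ∑ y, g y * (z y)⁻ := by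
    rw [← Finset.sum_add_distrib]
    refine Finset.sum_congr rfl fun y _ => ?_
    rw [← mul_add, posPart_add_negPart]
  have hP : 0 ≤ ∑ y, g y * (z y)⁺ :=
    Finset.sum_nonneg fun y _ => mul_nonneg (hg y) (posPart_nonneg _)
  have hN : 0 ≤ ∑ y, g y * (z y)⁻ :=
    Finset.sum_nonneg fun y _ => mul_nonneg (hg y) (negPart_nonneg _)
  rw [split f, split g, habs]
  set P := ∑ y, g y * (z y)⁺
  set N := ∑ y, g y * (z y)⁻
  set N' := ∑ y, f y * (z y)⁻
  have hexp : Real.exp ε ≤ 1 + 2 * ε := by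
    have := Real.abs_exp_sub_one_le (x := ε) (by rwa [abs_of_nonneg hε0])
    rw [abs_of_nonneg hε0] at this
    linarith [le_abs_self (Real.exp ε - 1)]
  have hinv : 1 - ε ≤ Real.exp (-ε) := by linarith [Real.add_one_le_exp (-ε)]
  have hinv1 : Real.exp (-ε) ≤ 1 := Real.exp_le_one_iff.2 (by linarith)
  have hδM : 0 ≤ δ * M := mul_nonneg hδ hM
  have hN' : Real.exp (-ε) * N ≤ N' + δ * M := by
    have h1 := mul_le_mul_of_nonneg_left hneg (Real.exp_pos (-ε)).le
    have h2 : Real.exp (-ε) * (Real.exp ε * N' + δ * M) = N' + Real.exp (-ε) * (δ * M) := by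
      rw [mul_add, ← mul_assoc, ← Real.exp_add]
      simp
    nlinarith
  nlinarith [mul_le_mul_of_nonneg_right hexp hP, mul_le_mul_of_nonneg_right hinv hN,
    mul_nonneg hε0 hN]

lemma sum_datasetMass_mul_scoreCorrelation_le {d n : ℕ} {p : Fin d → ℝ}
    (hp : ∀ j, 1 / 3 ≤ p j ∧ p j ≤ 2 / 3) {a : (Fin n → Fin d → Bool) → (Fin d → Bool) → ℝ}
    (ha0 : ∀ x y, 0 ≤ a x y) (ha1 : ∀ x, ∑ y, a x y = 1) {ε δ : ℝ} (hε0 : 0 ≤ ε) (hε1 : ε ≤ 1)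
    (hδ : 0 ≤ δ)
    (hDP : ∀ x x', Neighbors x x' → ∀ S : Finset (Fin d → Bool),
      ∑ y ∈ S, a x y ≤ Real.exp ε * ∑ y ∈ S, a x' y + δ) (i : Fin n) :
    ∑ x, datasetMass p x * ∑ y, a x y * scoreCorrelation p (x i) y
      ≤ 17 / 8 * ε * Real.sqrt d + 3 * δ * d := by
  let r₀ : Fin d → Bool := fun _ => false
  have hN : ∀ x : Fin n → Fin d → Bool, Neighbors x (Function.update x i r₀) := by
    have key : ∀ (x : Fin n → Fin d → Bool) k, x k ≠ Function.update x i r₀ k → k = i := by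
      intro x k hk
      by_contra h
      exact hk (Function.update_of_ne h _ _).symm
    exact fun x k hk l hl => (key x k hk).trans (key x l hl).symm
  have hN' : ∀ x : Fin n → Fin d → Bool, Neighbors (Function.update x i r₀) x := by
    intro x k hk l hl
    exact hN x (Ne.symm hk) (Ne.symm hl)
  have hpt : ∀ x : Fin n → Fin d → Bool, ∑ y, a x y * scoreCorrelation p (x i) y
      ≤ ∑ y, a (Function.update x i r₀) y * scoreCorrelation p (x i) y
        + 2 * ε * ∑ y, a (Function.update x i r₀) y * |scoreCorrelation p (x i) y|
        + 2 * (δ * (3 / 2 * d)) := fun x =>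
    sum_mul_le_of_indistinguishable hε0 hε1 hδ (ha0 _) (hDP _ _ (hN x)) (hDP _ _ (hN' x))
      (fun y => abs_scoreCorrelation_le hp (x i) y) (by positivity)
  -- The algorithm no longer sees `x i`, so that record can be averaged out for each fixed output.
  -- The identity gives the mean, `abs` the typical size.
  have resample : ∀ φ : ℝ → ℝ,
      ∑ x : Fin n → Fin d → Bool, datasetMass p x *
          ∑ y, a (Function.update x i r₀) y * φ (scoreCorrelation p (x i) y)
        = ∑ x : Fin n → Fin d → Bool, datasetMass p x *
          ∑ y, a (Function.update x i r₀) y *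
            ∑ r, recordMass p r * φ (scoreCorrelation p r y) := by
    intro φ
    refine (sum_prod_mul_eq_sum_resample (fun _ => recordMass p) i (sum_recordMass p) _).trans ?_
    refine Finset.sum_congr rfl fun x _ => ?_
    refine congrArg (datasetMass p x * ·) ?_
    simp only [Function.update_self, Function.update_idem, Finset.mul_sum]
    rw [Finset.sum_comm]
    exact Finset.sum_congr rfl fun y _ => Finset.sum_congr rfl fun r _ => by ring
  have h0 : ∑ x : Fin n → Fin d → Bool, datasetMass p x *
      ∑ y, a (Function.update x i r₀) y * scoreCorrelation p (x i) y = 0 := by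
    refine (resample id).trans ?_
    simp only [id, sum_recordMass_mul_scoreCorrelation hp, mul_zero, Finset.sum_const_zero]
  have h1 : ∑ x : Fin n → Fin d → Bool, datasetMass p x *
      ∑ y, a (Function.update x i r₀) y * |scoreCorrelation p (x i) y|
        ≤ 17 / 16 * Real.sqrt d := by
    refine (resample abs).le.trans ?_
    calc _ ≤ ∑ x : Fin n → Fin d → Bool, datasetMass p x * (17 / 16 * Real.sqrt d) := by
          refine Finset.sum_le_sum fun x _ =>
            mul_le_mul_of_nonneg_left ?_ (datasetMass_nonneg hp x)
          calc _ ≤ ∑ y, a (Function.update x i r₀) y * (17 / 16 * Real.sqrt d) :=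
                Finset.sum_le_sum fun y _ => mul_le_mul_of_nonneg_left
                  (sum_recordMass_mul_abs_scoreCorrelation hp y) (ha0 _ _)
            _ = _ := by rw [← Finset.sum_mul, ha1, one_mul]
      _ = _ := by rw [← Finset.sum_mul, sum_datasetMass, one_mul]
  calc _ ≤ ∑ x : Fin n → Fin d → Bool, datasetMass p x *
        (∑ y, a (Function.update x i r₀) y * scoreCorrelation p (x i) y
        + 2 * ε * ∑ y, a (Function.update x i r₀) y * |scoreCorrelation p (x i) y|
        + 2 * (δ * (3 / 2 * d))) :=
        Finset.sum_le_sum fun x _ => mul_le_mul_of_nonneg_left (hpt x) (datasetMass_nonneg hp x)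
    _ = 0 + 2 * ε * ∑ x : Fin n → Fin d → Bool, datasetMass p x *
          ∑ y, a (Function.update x i r₀) y * |scoreCorrelation p (x i) y|
        + 2 * (δ * (3 / 2 * d)) := by
        rw [← h0]
        simp only [mul_add, Finset.sum_add_distrib]
        rw [← Finset.sum_mul, sum_datasetMass, one_mul, Finset.mul_sum]
        congr 2
        exact Finset.sum_congr rfl fun x _ => by ring
    _ ≤ _ := by nlinarith

end Privacy

/-! ### Lower bound on the divergence from the flux through the cube -/

section Divergence

variable {m : ℕ}

/-- A vector field on the cube `[1/3, 2/3]^(m+1)` that is `α`-close to a translation of the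
identity has divergence at least `(m + 1) (1 - 6 α)` somewhere. -/
lemma le_of_divergence_le {G : Fin (m + 1) → (Fin (m + 1) → ℝ) → ℝ}
    (hG : ∀ j, ContDiff ℝ 1 (G j)) {α B c : ℝ}
    (hα : ∀ p : Fin (m + 1) → ℝ, (∀ j, 1 / 3 ≤ p j ∧ p j ≤ 2 / 3) → ∀ j, |G j p - (p j - c)| ≤ α)
    (hB : ∀ p : Fin (m + 1) → ℝ, (∀ j, 1 / 3 ≤ p j ∧ p j ≤ 2 / 3) →
      ∑ j, fderiv ℝ (G j) p (Pi.single j 1) ≤ B) :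
    (m + 1) * (1 - 6 * α) ≤ B := by
  let lo : Fin (m + 1) → ℝ := fun _ => 1 / 3
  let hi : Fin (m + 1) → ℝ := fun _ => 2 / 3
  have hle : lo ≤ hi := fun _ => by norm_num [lo, hi]
  have hcont : Continuous fun p => ∑ j, fderiv ℝ (G j) p (Pi.single j 1) :=
    continuous_finsetSum _ fun j _ =>
      ((hG j).continuous_fderiv (by norm_num)).clm_apply continuous_const
  have hdiv := integral_divergence_of_hasFDerivAt_off_countable' lo hi hle G
    (fun j => fderiv ℝ (G j)) ∅ Set.countable_empty (fun j => (hG j).continuous.continuousOn)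
    (fun p _ j => ((hG j).differentiable (by norm_num) p).hasFDerivAt)
    hcont.continuousOn.integrableOn_Icc
  have hupper : ∫ p in Set.Icc lo hi, ∑ j, fderiv ℝ (G j) p (Pi.single j 1)
      ≤ (1 / 3) ^ (m + 1) * B := by
    calc _ ≤ ∫ _p in Set.Icc lo hi, B :=
          setIntegral_mono_on hcont.continuousOn.integrableOn_Icc
            continuousOn_const.integrableOn_Icc measurableSet_Icc
            fun p hp => hB p fun j => ⟨hp.1 j, hp.2 j⟩
      _ = _ := by
          rw [setIntegral_const, measureReal_def, Real.volume_Icc_pi_toReal hle, smul_eq_mul]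
          congr 1
          simp only [lo, hi, Finset.prod_const, Finset.card_univ, Fintype.card_fin]
          norm_num
  -- Between opposite faces `p j - c` grows by 1/3, with an error of at most `α` on each face; a
  -- face has volume `(1/3)^m`.
  have hface : ∀ j : Fin (m + 1), (1 / 3) ^ m * (1 / 3 - 2 * α) ≤
      (∫ q in Set.Icc (lo ∘ j.succAbove) (hi ∘ j.succAbove), G j (j.insertNth (hi j) q)) -
        ∫ q in Set.Icc (lo ∘ j.succAbove) (hi ∘ j.succAbove), G j (j.insertNth (lo j) q) := by
    intro j
    have hc : ∀ t : ℝ, Continuous fun q : Fin m → ℝ => G j (j.insertNth t q) := fun t =>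
      (hG j).continuous.comp (continuous_const.finInsertNth j continuous_id)
    have hmem : ∀ t : ℝ, 1 / 3 ≤ t → t ≤ 2 / 3 →
        ∀ q ∈ Set.Icc (lo ∘ j.succAbove) (hi ∘ j.succAbove),
          |G j (j.insertNth t q) - (t - c)| ≤ α := by
      intro t h0 h1 q hq
      have h := hα (j.insertNth t q) (fun k => ?_) j
      · rwa [Fin.insertNth_apply_same] at h
      · refine Fin.succAboveCases j ?_ (fun k => ?_) k
        · rw [Fin.insertNth_apply_same]; exact ⟨h0, h1⟩
        · rw [Fin.insertNth_apply_succAbove]; exact ⟨hq.1 k, hq.2 k⟩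
    rw [← integral_sub (hc _).continuousOn.integrableOn_Icc (hc _).continuousOn.integrableOn_Icc]
    calc _ = ∫ _q in Set.Icc (lo ∘ j.succAbove) (hi ∘ j.succAbove), (1 / 3 - 2 * α) := by
          rw [setIntegral_const, measureReal_def,
            Real.volume_Icc_pi_toReal (a := lo ∘ j.succAbove) (b := hi ∘ j.succAbove)
              (fun k => hle (j.succAbove k)), smul_eq_mul]
          congr 1
          simp only [lo, hi, Function.comp_apply, Finset.prod_const, Finset.card_univ,
            Fintype.card_fin]
          norm_num
      _ ≤ _ := by
          refine setIntegral_mono_on continuousOn_const.integrableOn_Icc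
            ((hc _).sub (hc _)).continuousOn.integrableOn_Icc measurableSet_Icc fun q hq => ?_
          have h1 := abs_le.1 (hmem (hi j) (by norm_num [hi]) (by norm_num [hi]) q hq)
          have h2 := abs_le.1 (hmem (lo j) (by norm_num [lo]) (by norm_num [lo]) q hq)
          simp only [lo, hi] at h1 h2 ⊢
          linarith [h1.1, h2.2]
  have hlower : (m + 1) * ((1 / 3) ^ m * (1 / 3 - 2 * α)) ≤ (1 / 3) ^ (m + 1) * B := by
    calc _ = ∑ _j : Fin (m + 1), ((1 / 3 : ℝ) ^ m * (1 / 3 - 2 * α)) := by simp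
      _ ≤ _ := (Finset.sum_le_sum fun j _ => hface j).trans (hdiv.symm.le.trans hupper)
  have h3 : (0 : ℝ) < (1 / 3) ^ (m + 1) := by positivity
  refine le_of_mul_le_mul_left (le_trans (le_of_eq ?_) hlower) h3
  rw [pow_succ]
  ring

end Divergence

/-! ### Differentiating the dataset mass -/

section Score

variable {d n : ℕ}

lemma datasetMass_eq_prod_pairs (p : Fin d → ℝ) (x : Fin n → Fin d → Bool) :
    datasetMass p x = ∏ k : Fin n × Fin d, bitMass (p k.2) (x k.1 k.2) := by
  simp only [datasetMass, recordMass, Fintype.prod_prod_type]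

lemma contDiff_datasetMass (x : Fin n → Fin d → Bool) :
    ContDiff ℝ 1 fun p : Fin d → ℝ => datasetMass p x := by
  refine contDiff_prod fun i _ => contDiff_prod fun j _ => ?_
  cases h : x i j
  · simpa [bitMass] using contDiff_const.sub (contDiff_apply ℝ ℝ j)
  · simpa [bitMass] using contDiff_apply ℝ ℝ j

lemma hasFDerivAt_bitMass (p : Fin d → ℝ) (j : Fin d) (b : Bool) :
    HasFDerivAt (fun p : Fin d → ℝ => bitMass (p j) b)
      ((if b then (1 : ℝ) else -1) • ContinuousLinearMap.proj (R := ℝ) (φ := fun _ => ℝ) j) p := by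
  have h : HasFDerivAt (fun p : Fin d → ℝ => p j)
      (ContinuousLinearMap.proj (R := ℝ) (φ := fun _ => ℝ) j) p := hasFDerivAt_apply j p
  cases b
  · simp only [bitMass, Bool.false_eq_true, if_false]
    exact (h.const_sub 1).congr_fderiv (by ext; simp)
  · simpa [bitMass] using h

/-- The partial derivatives of the mass of a dataset are given by the score. -/
lemma fderiv_datasetMass {p : Fin d → ℝ} (hp : ∀ j, 1 / 3 ≤ p j ∧ p j ≤ 2 / 3)
    (x : Fin n → Fin d → Bool) (j : Fin d) :
    fderiv ℝ (fun p : Fin d → ℝ => datasetMass p x) p (Pi.single j 1)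
      = datasetMass p x * ∑ i, bitScore (p j) (x i j) := by
  simp only [datasetMass_eq_prod_pairs]
  rw [(HasFDerivAt.finsetProd (u := Finset.univ)
    fun k _ => hasFDerivAt_bitMass p k.2 (x k.1 k.2)).fderiv]
  simp only [sum_apply, smul_apply,
    ContinuousLinearMap.proj_apply, smul_eq_mul]
  -- Since `bitMass * bitScore` is 1 or -1, the factor removed by the product rule can be restored
  -- at the price of a score.
  have hterm : ∀ k : Fin n × Fin d,
      (∏ l ∈ Finset.univ.erase k, bitMass (p l.2) (x l.1 l.2)) *
        ((if x k.1 k.2 then (1 : ℝ) else -1) * (Pi.single j 1 : Fin d → ℝ) k.2)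
      = (∏ l : Fin n × Fin d, bitMass (p l.2) (x l.1 l.2)) *
        if k.2 = j then bitScore (p j) (x k.1 j) else 0 := by
    intro k
    rw [← Finset.mul_prod_erase Finset.univ _ (Finset.mem_univ k)]
    by_cases hk : k.2 = j
    · subst hk
      have h0 : p k.2 ≠ 0 := by linarith [(hp k.2).1]
      have h1 : 1 - p k.2 ≠ 0 := by linarith [(hp k.2).2]
      cases hx : x k.1 k.2 <;> simp [bitMass, bitScore] <;> field_simp
    · simp [hk]
  simp only [hterm]
  rw [← Finset.mul_sum, Fintype.sum_prod_type]
  simp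

end Score

/-! ### From measures to finite sums, and the dimension bound -/

section Link

variable {d n : ℕ}

lemma productBernoulli_real_singleton (p : Fin d → unitInterval) (r : Fin d → Bool) :
    (productBernoulli p).real {r} = recordMass (fun j => (p j : ℝ)) r := by
  rw [productBernoulli, measureReal_def, Measure.pi_singleton, ENNReal.toReal_prod, recordMass]
  refine Finset.prod_congr rfl fun j _ => ?_
  rw [← measureReal_def, bernoulliMeasure_real_apply _ (measurableSet_singleton _)]
  cases r j <;> simp [bitMass]

instance (p : Fin d → unitInterval) : IsProbabilityMeasure (productBernoulli p) := by
  unfold productBernoulli; infer_instance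

lemma productBernoulli_real_coord (p : Fin d → unitInterval) (j : Fin d) :
    (productBernoulli p).real {y | y j = true} = p j := by
  have h : {y : Fin d → Bool | y j = true} = Function.eval j ⁻¹' ({true} : Set Bool) := rfl
  rw [h, productBernoulli, measureReal_def,
    (measurePreserving_eval _ j).measure_preimage (measurableSet_singleton _).nullMeasurableSet,
    ← measureReal_def, bernoulliMeasure_real_apply _ (measurableSet_singleton _)]
  simp

lemma outputDist_real (A : Algorithm n (Fin d → Bool) (Fin d → Bool)) [IsMarkovKernel A]
    (p : Fin d → unitInterval) (E : Set (Fin d → Bool)) :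
    (outputDist A (productBernoulli p)).real E
      = ∑ x, datasetMass (fun j => (p j : ℝ)) x * (A x).real E := by
  have hE : MeasurableSet E := Set.Finite.measurableSet E.toFinite
  rw [outputDist, measureReal_def, Measure.bind_apply hE A.measurable.aemeasurable,
    lintegral_fintype, ENNReal.toReal_sum (fun x _ => by finiteness)]
  refine Finset.sum_congr rfl fun x _ => ?_
  rw [ENNReal.toReal_mul, Measure.pi_singleton, ENNReal.toReal_prod, mul_comm, datasetMass]
  simp only [← measureReal_def, productBernoulli_real_singleton]

instance (A : Algorithm n (Fin d → Bool) (Fin d → Bool)) [IsMarkovKernel A]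
    (P : Measure (Fin d → Bool)) [IsProbabilityMeasure P] :
    IsProbabilityMeasure (outputDist A P) := by
  unfold outputDist; infer_instance

/-- The family must be shown bounded (by 1), because a real supremum of an unbounded family defaults
to 0. -/
lemma abs_sub_le_tvDist {U : Type*} [MeasurableSpace U] (P Q : Measure U)
    [IsProbabilityMeasure P] [IsProbabilityMeasure Q] {E : Set U} (hE : MeasurableSet E) :
    |P.real E - Q.real E| ≤ tvDist P Q := by
  refine le_ciSup (f := fun E : {E : Set U // MeasurableSet E} => |P.real E.1 - Q.real E.1|)
    ⟨1, ?_⟩ ⟨E, hE⟩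
  rintro _ ⟨E, rfl⟩
  have h1 := measureReal_nonneg (μ := P) (s := E.1)
  have h2 := measureReal_nonneg (μ := Q) (s := E.1)
  have h3 := measureReal_le_one (μ := P) (s := E.1)
  have h4 := measureReal_le_one (μ := Q) (s := E.1)
  exact abs_le.2 ⟨by linarith, by linarith⟩

lemma sum_real_singleton_mul_centeredBit (Q : Measure (Fin d → Bool)) [IsProbabilityMeasure Q]
    (j : Fin d) : ∑ y, Q.real {y} * centeredBit (y j) = Q.real {y | y j = true} - 1 / 2 := by
  have hS : Q.real {y | y j = true} = ∑ y, Q.real {y} * if y j then 1 else 0 := by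
    have h : {y : Fin d → Bool | y j = true}
        = ((Finset.univ.filter fun y : Fin d → Bool => y j = true : Finset _) : Set _) := by
      ext; simp
    rw [h, ← sum_measureReal_singleton, Finset.sum_filter]
    exact Finset.sum_congr rfl fun y _ => by split_ifs <;> simp
  have h1 : ∑ y, Q.real {y} = 1 := by
    rw [sum_measureReal_singleton, Finset.coe_univ, probReal_univ]
  rw [hS, ← one_mul (1 / 2 : ℝ), ← h1, Finset.sum_mul, ← Finset.sum_sub_distrib]
  refine Finset.sum_congr rfl fun y _ => ?_
  cases y j
  · simp [centeredBit]
  · simp [centeredBit]; ring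

/-- The dimension is bounded by the total fingerprinting correlation that privacy allows. -/
lemma dimension_le_of_isDP_of_isAccurateOn {m n : ℕ} {α ε δ : ℝ} (hε0 : 0 ≤ ε) (hε1 : ε ≤ 1)
    (hδ : 0 ≤ δ) (A : Algorithm n (Fin (m + 1) → Bool) (Fin (m + 1) → Bool)) [IsMarkovKernel A]
    (hDP : IsDP A ε δ) (hA : IsAccurateOn A α (boundedBiasProducts (m + 1))) :
    (m + 1) * (1 - 6 * α)
      ≤ n * (17 / 8 * ε * Real.sqrt (m + 1 : ℕ) + 3 * δ * (m + 1 : ℕ)) := by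
  let a : (Fin n → Fin (m + 1) → Bool) → (Fin (m + 1) → Bool) → ℝ := fun x y => (A x).real {y}
  let G : Fin (m + 1) → (Fin (m + 1) → ℝ) → ℝ := fun j p =>
    ∑ x, datasetMass p x * ∑ y, a x y * centeredBit (y j)
  have ha : ∀ x (S : Finset (Fin (m + 1) → Bool)), ∑ y ∈ S, a x y = (A x).real S := fun x S =>
    sum_measureReal_singleton S
  refine le_of_divergence_le (G := G) (c := 1 / 2)
    (fun j => ContDiff.sum fun x _ => (contDiff_datasetMass x).mul contDiff_const) ?_ ?_
  · intro p hp j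
    let P : Fin (m + 1) → unitInterval := fun k =>
      ⟨p k, by linarith [(hp k).1], by linarith [(hp k).2]⟩
    have hGj : G j p = (outputDist A (productBernoulli P)).real {y | y j = true} - 1 / 2 := by
      simp only [G, a, sum_real_singleton_mul_centeredBit, outputDist_real, mul_sub,
        Finset.sum_sub_distrib]
      rw [← Finset.sum_mul, sum_datasetMass, one_mul]
    have hpj : p j = (productBernoulli P).real {y | y j = true} :=
      (productBernoulli_real_coord P j).symm
    rw [hGj, hpj, sub_sub_sub_cancel_right]
    exact (abs_sub_le_tvDist _ _ (Set.Finite.measurableSet (Set.toFinite _))).trans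
      (hA _ ⟨P, hp, rfl⟩)
  · intro p hp
    have hderiv : ∀ j, fderiv ℝ (G j) p (Pi.single j 1)
        = ∑ x, datasetMass p x * (∑ i, bitScore (p j) (x i j)) *
            ∑ y, a x y * centeredBit (y j) := by
      intro j
      have hd : ∀ x : Fin n → Fin (m + 1) → Bool,
          DifferentiableAt ℝ (fun p : Fin (m + 1) → ℝ => datasetMass p x) p := fun x =>
        (contDiff_datasetMass x).differentiable (by norm_num) p
      simp only [G]
      rw [fderiv_fun_sum fun x _ => (hd x).mul_const _]
      simp only [sum_apply]
      refine Finset.sum_congr rfl fun x _ => ?_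
      rw [fderiv_mul_const (hd x), smul_apply, fderiv_datasetMass hp,
        smul_eq_mul, mul_comm]
    -- Exchanging the sums over coordinates and records groups the divergence by record.
    calc _ = ∑ i : Fin n, ∑ x, datasetMass p x * ∑ y, a x y * scoreCorrelation p (x i) y := by
          simp only [hderiv]
          rw [Finset.sum_comm, Finset.sum_comm (γ := Fin n)]
          refine Finset.sum_congr rfl fun x _ => ?_
          simp only [scoreCorrelation, Finset.mul_sum, Finset.sum_mul]
          rw [Finset.sum_comm_cycle]
          refine Finset.sum_congr rfl fun i _ => ?_
          rw [Finset.sum_comm]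
          exact Finset.sum_congr rfl fun _ _ => Finset.sum_congr rfl fun _ _ => by ring
      _ ≤ ∑ _i : Fin n, (17 / 8 * ε * Real.sqrt (m + 1 : ℕ) + 3 * δ * (m + 1 : ℕ)) := by
          refine Finset.sum_le_sum fun i _ =>
            sum_datasetMass_mul_scoreCorrelation_le hp (fun x y => measureReal_nonneg)
              (fun x => ?_) hε0 hε1 hδ (fun x x' hx S => ?_) i
          · rw [ha, Finset.coe_univ, probReal_univ]
          · rw [ha, ha]
            exact hDP x x' hx S S.measurableSet
      _ = _ := by rw [Finset.sum_const, Finset.card_univ, Fintype.card_fin, nsmul_eq_mul]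

end Link

end PrivateSampling

/-! ### Choice of the constants -/

theorem theorem1p9 :
    ∃ α₀ : ℝ, 0 < α₀ ∧ ∃ c : ℝ, 0 < c ∧
      ∀ α : ℝ, 0 < α → α ≤ α₀ →
      ∀ (d n : ℕ) (ε δ : ℝ), 0 < ε → ε ≤ 1 → 0 ≤ δ → δ ≤ 1 / (100 * (n : ℝ)) →
        (∃ A : PrivateSampling.Algorithm n (Fin d → Bool) (Fin d → Bool),
          ProbabilityTheory.IsMarkovKernel A ∧
          PrivateSampling.IsDP A ε δ ∧
          PrivateSampling.IsAccurateOn A α (PrivateSampling.boundedBiasProducts d)) →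
        c * (Real.sqrt d / ε) ≤ (n : ℝ) := by
  refine ⟨1 / 12, by norm_num, 1 / 5, by norm_num, ?_⟩
  rintro α - hα d n ε δ hε0 hε1 hδ0 hδ ⟨A, hM, hDP, hA⟩
  rcases d with - | m
  · simp
  have h := PrivateSampling.dimension_le_of_isDP_of_isAccurateOn hε0.le hε1 hδ0 A hDP hA
  have hnδ : n * δ ≤ 1 / 100 := by
    -- For `n = 0` the product vanishes whatever `δ` is.
    rcases Nat.eq_zero_or_pos n with rfl | hn
    · norm_num
    · have hn' : (0 : ℝ) < n := by exact_mod_cast hn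
      rw [le_div_iff₀ (by positivity)] at hδ
      linarith
  set s := Real.sqrt (m + 1 : ℕ) with hs
  have hs0 : 0 < s := Real.sqrt_pos.2 (by positivity)
  have hss : s * s = m + 1 := by rw [hs, Real.mul_self_sqrt (by positivity)]; push_cast; ring
  push_cast at h
  rw [← hss] at h
  -- `1 - 6α ≥ 1/2` and `3 n δ ≤ 3/100` leave 47/100; then `(47/100) / (17/8) > 1/5` is the constant
  -- `c`.
  have h1 : s * (s * (47 / 100)) ≤ s * (17 / 8 * (n * ε)) := by
    nlinarith [mul_le_mul_of_nonneg_left hα (mul_pos hs0 hs0).le,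
      mul_le_mul_of_nonneg_right hnδ (mul_pos hs0 hs0).le]
  have h2 := le_of_mul_le_mul_left h1 hs0
  rw [← mul_div_assoc, div_le_iff₀ hε0]
  linarith
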